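/- Let $r\ge 1$ and let $f\in\mathbb{C}[Z_1,\dots,Z_n]$. For $h=\sum_{\alpha}c_\alpha Z^\alpha\in\mathbb{C}[Z_1,\dots,Z_n]$ and $v\in\mathbb{R}^n$, say that the exponent $a\in\operatorname{supp}h$ is dominant for $h$ at $v$ if $|c_a|e^{\langle a,v\rangle}>\sum_{b\in\operatorname{supp}h,\,b\ne a}|c_b|e^{\langle b,v\rangle}$, and let $\mathcal{LA}(h)$ be the set of all $v\in\mathbb{R}^n$ at which no exponent is dominant for $h$. Let $\mathcal{A}_f=\{(\log|z_1|,\dots,\log|z_n|) : z\in(\mathbb{C}^*)^n,\ f(z)=0\}$ be the amoeba of $f$, and let $$\tilde f_r(Z)=\prod_{k_1=0}^{r-1}\cdots\prod_{k_n=0}^{r-1} f\left(e^{2\pi i k_1/r}Z_1,\dots,e^{2\pi i k_n/r}Z_n\right).$$ Write $p(X+iY)=p^{\mathrm{re}}(X,Y)+i\,p^{\mathrm{im}}(X,Y)$ with $p^{\mathrm{re}},p^{\mathrm{im}}\in\mathbb{R}[X_1,\dots,X_n,Y_1,\dots,Y_n]$. A certificate of degree at most $D$ for $h$ (at the point $\mathbf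 1=(1,\dots,1)$) is a polynomial identity $$\sum_{b\in\operatorname{supp}h}K_b\left(\left((Z^b)^{\mathrm{re}}\right)^2+\left((Z^b)^{\mathrm{im}}\right)^2-1\right)+K_{\mathrm{re}}h^{\mathrm{re}}+K_{\mathrm{im}}h^{\mathrm{im}}+H+1=0$$ in $\mathbb{R}[X,Y]$ in which $H$ is a sum of squares of polynomials and each summand has total degree at most $D$. Let $w\in\mathbb{R}^n\setminus\mathcal{LA}(\tilde f_r)$ and $g(Z)=f(e^{w_1}Z_1,\dots,e^{w_n}Z_n)$. Then $w\notin\mathcal{A}_f$, and the following holds. (1) The polynomial $\tilde g_r=\sum_b c_bZ^b$ has a dominant exponent $a$ at $0$. With $S=\operatorname{supp}(\tilde g_r)\setminus\{a\}$ and $\kappa=|c_a|^2-\left(\sum_{b\in S}|c_b|\right)^2$, the explicit polynomials $$K_a=\frac{|c_a|^2}{\kappa},\qquad K_b=-\frac{|c_b|}{\kappa}\sum_{k\in S}|c_k|\quad(b\in S),$$ $$K_{\mathrm{re}}=\frac1\kappa\Big(-c_aZ^a+\sum_{b\in S}c_bZ^b\Big)^{\mathrm{re}},\qquad K_{\mathrm{im}}=\frac1\kappa\Big(-c_aZ^a+\sum_{b\in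 S}c_bZ^b\Big)^{\mathrm{im}},$$ $$H=\frac1\kappa\sum_{\{b,b'\}\subset S,\ b\ne b'}|c_b||c_{b'}|\left(\left(\left(u_b-u_{b'}\right)^{\mathrm{re}}\right)^2+\left(\left(u_b-u_{b'}\right)^{\mathrm{im}}\right)^2\right),\qquad u_b=\frac{c_b}{|c_b|}Z^b,$$ form a certificate of degree at most $2\,r^n\deg f$ for $\tilde g_r$. Moreover there is a certificate of degree at most $2\,r^n\deg f$ for $g$ with the same sum of squares $H$. (2) This certificate for $\tilde g_r$ determines the order of the component of $\mathbb{R}^n\setminus\mathcal{A}_f$ that contains $w$: $a$ is the only exponent whose multiplier $K_a$ is positive, and $a=r^n\nu$ with $\nu\in\mathbb{N}_0^n$, where for every $u$ in that component and $1\le j\le n$ $$\nu_j=\frac{1}{(2\pi i)^n}\int_{|z_1|=e^{u_1},\dots,|z_n|=e^{u_n}}\frac{z_j\,\partial_jf(z)}{f(z)}\,\frac{dz_1\cdots dz_n}{z_1\cdots z_n}.$$ -/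

import Mathlib

open MvPolynomial

noncomputable section

namespace Amoeba

/-! ### Amoebas, orders, lopsidedness -/

/-- The (log) amoeba of an ideal `I ⊆ ℂ[Z₁, …, Zₙ]`: the image of `V(I) ∩ (ℂ*)ⁿ` under
`z ↦ (log |z₁|, …, log |zₙ|)`. -/
def amoeba {n : ℕ} (I : Ideal (MvPolynomial (Fin n) ℂ)) : Set (Fin n → ℝ) :=
  {v | ∃ z ∈ zeroLocus ℂ I, (∀ i, z i ≠ 0) ∧ v = fun i => Real.log ‖z i‖}

/-- The amoeba of the hypersurface defined by `f`. -/
def hypersurfaceAmoeba {n : ℕ} (f : MvPolynomial (Fin n) ℂ) : Set (Fin n → ℝ) :=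
  amoeba (Ideal.span {f})

/-- The order of a point `w` of the complement of the amoeba of `f`:
`ν_j = (2πi)⁻ⁿ ∫_{Log⁻¹(w)} (z_j ∂_j f(z) / f(z)) dz₁ ⋯ dzₙ / (z₁ ⋯ zₙ)`. -/
def order {n : ℕ} (f : MvPolynomial (Fin n) ℂ) (w : Fin n → ℝ) (j : Fin n) : ℂ :=
  ((2 * (Real.pi : ℂ) * Complex.I) ^ n)⁻¹ *
    torusIntegral (fun z => z j * eval z (pderiv j f) / eval z f / ∏ i, z i)
      0 (fun i => Real.exp (w i))

/-- The absolute value `|c_α z^α|` of the `α`-th term of `f` at any `z` with `Log z = v`.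
The family of these numbers over `α ∈ supp f` is `f{v}`. -/
def termAbs {n : ℕ} (f : MvPolynomial (Fin n) ℂ) (v : Fin n → ℝ) (a : Fin n →₀ ℕ) : ℝ :=
  ‖coeff a f‖ * ∏ i, Real.exp (v i) ^ a i

/-- The term of `f` with exponent `a` dominates at `v`: its absolute value is greater than the sum
of the absolute values of all other terms. -/
def IsDominant {n : ℕ} (f : MvPolynomial (Fin n) ℂ) (v : Fin n → ℝ) (a : Fin n →₀ ℕ) : Prop :=
  a ∈ f.support ∧ ∑ b ∈ f.support.erase a, termAbs f v b < termAbs f v a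

/-- The lopsided approximation `LA(f)`: all points at which `f{v}` is not lopsided. -/
def lopsidedApprox {n : ℕ} (f : MvPolynomial (Fin n) ℂ) : Set (Fin n → ℝ) :=
  {v | ¬ ∃ a, IsDominant f v a}

/-- The polynomial `f(c₁ Z₁, …, cₙ Zₙ)`. -/
def rescale {n : ℕ} (c : Fin n → ℂ) (f : MvPolynomial (Fin n) ℂ) : MvPolynomial (Fin n) ℂ :=
  aeval (fun i => C (c i) * X i) f

/-- The product `f̃_r` of all `f(ζ₁ Z₁, …, ζₙ Zₙ)` with `ζ₁, …, ζₙ` running over the `r`-th roots of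
unity. -/
def rootProduct {n : ℕ} (r : ℕ) (f : MvPolynomial (Fin n) ℂ) : MvPolynomial (Fin n) ℂ :=
  ∏ k : Fin n → Fin r,
    rescale (fun i => Complex.exp (2 * Real.pi * Complex.I * ((k i : ℕ) : ℂ) / r)) f

/-- The normalization `g(Z) = f(λ₁ Z₁, …, λₙ Zₙ)`, `λ_i = exp (w_i)`, which moves the point `w` to
the origin (that is, `λ` to the all-ones vector). -/
def normalize {n : ℕ} (w : Fin n → ℝ) (f : MvPolynomial (Fin n) ℂ) : MvPolynomial (Fin n) ℂ :=
  rescale (fun i => (Real.exp (w i) : ℂ)) f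

/-! ### Real and imaginary parts -/

/-- `ℝ[X₁, …, Xₙ, Y₁, …, Yₙ]`, with `X_k` the variable `Sum.inl k` and `Y_k` the variable
`Sum.inr k`. -/
abbrev RealPoly (n : ℕ) : Type := MvPolynomial (Fin n ⊕ Fin n) ℝ

/-- `p(X + iY)` as a polynomial in `X, Y` with complex coefficients. -/
def substXY {n : ℕ} (p : MvPolynomial (Fin n) ℂ) : MvPolynomial (Fin n ⊕ Fin n) ℂ :=
  aeval (fun k => X (Sum.inl k) + C Complex.I * X (Sum.inr k)) p

/-- The real part `p^re` in `p(X + iY) = p^re(X, Y) + i p^im(X, Y)`. -/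
def rePart {n : ℕ} (p : MvPolynomial (Fin n) ℂ) : RealPoly n :=
  ∑ m ∈ (substXY p).support, monomial m (coeff m (substXY p)).re

/-- The imaginary part `p^im` in `p(X + iY) = p^re(X, Y) + i p^im(X, Y)`. -/
def imPart {n : ℕ} (p : MvPolynomial (Fin n) ℂ) : RealPoly n :=
  ∑ m ∈ (substXY p).support, monomial m (coeff m (substXY p)).im

/-! ### Monomial-based sum of squares certificates at the point `𝟏` -/

/-- The generator `((Z^b)^re)² + ((Z^b)^im)² - 1`. -/
def monomialGen {n : ℕ} (b : Fin n →₀ ℕ) : RealPoly n :=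
  rePart (monomial b 1) ^ 2 + imPart (monomial b 1) ^ 2 - 1

/-- The data of a certificate: multipliers of the generators `((Z^b)^re)² + ((Z^b)^im)² - 1`, of
`h^re` and of `h^im`, and a polynomial which is to be a sum of squares. -/
structure Certificate (n : ℕ) where
  monMult : (Fin n →₀ ℕ) → RealPoly n
  reMult : RealPoly n
  imMult : RealPoly n
  sos : RealPoly n

/-- `K` is a certificate of degree at most `D` for the point `𝟏` with respect to `h`: an identity
`∑_b K_b (((Z^b)^re)² + ((Z^b)^im)² - 1) + K_re h^re + K_im h^im + H + 1 = 0`, with `b` running over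
the exponents of `h` and `H` a sum of squares, in which every summand has total degree at
most `D`. -/
def Certificate.IsValid {n : ℕ} (K : Certificate n) (h : MvPolynomial (Fin n) ℂ) (D : ℕ) : Prop :=
  (∑ b ∈ h.support, monomialGen b * K.monMult b) + rePart h * K.reMult + imPart h * K.imMult
      + K.sos + 1 = 0 ∧
  IsSumSq K.sos ∧
  (∀ b ∈ h.support, (monomialGen b * K.monMult b).totalDegree ≤ D) ∧
  (rePart h * K.reMult).totalDegree ≤ D ∧
  (imPart h * K.imMult).totalDegree ≤ D ∧
  K.sos.totalDegree ≤ D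

/-- The number `|c_a|² - (∑_{b ≠ a} |c_b|)²`, where `c_b` are the coefficients of `h`. -/
def gap {n : ℕ} (h : MvPolynomial (Fin n) ℂ) (a : Fin n →₀ ℕ) : ℝ :=
  ‖coeff a h‖ ^ 2 - (∑ b ∈ h.support.erase a, ‖coeff b h‖) ^ 2

/-- The term `c_b Z^b` of `h`. -/
def term {n : ℕ} (h : MvPolynomial (Fin n) ℂ) (b : Fin n →₀ ℕ) : MvPolynomial (Fin n) ℂ :=
  monomial b (coeff b h)

/-- The unimodular multiple `(c_b / |c_b|) Z^b` of the monomial `Z^b`. -/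
def unitTerm {n : ℕ} (h : MvPolynomial (Fin n) ℂ) (b : Fin n →₀ ℕ) : MvPolynomial (Fin n) ℂ :=
  monomial b (coeff b h / (‖coeff b h‖ : ℂ))

/-- The explicit certificate attached to a polynomial `h` whose term with exponent `a` dominates at
the origin. With `κ = gap h a`, and `S` the set of exponents of `h` other than `a`, it consists of
* the multipliers `|c_a|² / κ` for `b = a` and `-|c_b| (∑_{k ∈ S} |c_k|) / κ` for `b ∈ S`;
* the real and the imaginary part of `-c_a Z^a + ∑_{b ∈ S} c_b Z^b`, divided by `κ`;
* `κ⁻¹` times the sum over all unordered pairs `{b, b'}` in `S` of `|c_b| |c_b'|` times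
  `((u_b - u_b')^re)² + ((u_b - u_b')^im)²`, where `u_b = (c_b / |c_b|) Z^b`.
The factor `1/2` accounts for the sum over ordered pairs. -/
def lopsidedCertificate {n : ℕ} (h : MvPolynomial (Fin n) ℂ) (a : Fin n →₀ ℕ) : Certificate n where
  monMult b :=
    if b = a then C ((gap h a)⁻¹ * ‖coeff a h‖ ^ 2)
    else C ((gap h a)⁻¹ * (-‖coeff b h‖ * ∑ k ∈ h.support.erase a, ‖coeff k h‖))
  reMult := C (gap h a)⁻¹ * rePart (-term h a + ∑ b ∈ h.support.erase a, term h b)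
  imMult := C (gap h a)⁻¹ * imPart (-term h a + ∑ b ∈ h.support.erase a, term h b)
  sos := C ((gap h a)⁻¹ / 2) * ∑ p ∈ (h.support.erase a).offDiag,
    C (‖coeff p.1 h‖ * ‖coeff p.2 h‖) *
      ((rePart (unitTerm h p.1) - rePart (unitTerm h p.2)) ^ 2
        + (imPart (unitTerm h p.1) - imPart (unitTerm h p.2)) ^ 2)

end Amoeba

end

/-! Write `s_b = |c_b|` and let `T` be the sum of the non-dominant terms. In the certificate for the
product over rotations, the multipliers of the real and imaginary parts contribute `κ⁻¹ (|T|² - |c_a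
Z^a|²)`, a difference of squares in each part. Lagrange's identity turns the sum of squares into
`κ⁻¹ ((∑ s_b)(∑ s_b |Z^b|²) - |T|²)`. Adding the monomial generators cancels everything but `κ⁻¹ ((∑
s_b)² - s_a²) = -1`; dominance is exactly what makes `κ` positive (`lopsidedCertificate_identity`,
`gap_pos`).

The product is `g * q`. Expanding its real and imaginary parts moves `q` into the multipliers, and
its exponents lie in the monoid generated by those of `g`, so their generators telescope into
generators for `g` (`exists_monomialGen_eq_sum`, `Certificate.IsValid.of_mul`).

For the order, Rouché's theorem on a coordinate circle shows that a dominant term has winding number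
`a j` (`windingNumber_of_isDominant`). This is also the sum of `r ^ n` winding numbers of `f` at
rotated base points. These are integers depending continuously on the point, hence all equal, and
the order is their average over the torus (`windingNumber_eq_of_mem_connectedComponentIn`,
`order_eq_of_windingNumber_eq`). -/

namespace Amoeba

/-! ### Arithmetic and degrees of real and imaginary parts. -/

section RealImaginaryParts

variable {n : ℕ}

theorem coeff_rePart (p : MvPolynomial (Fin n) ℂ) (m : Fin n ⊕ Fin n →₀ ℕ) :
    coeff m (rePart p) = (coeff m (substXY p)).re := by
  classical
  simp only [rePart, coeff_sum, coeff_monomial, Finset.sum_ite_eq']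
  split_ifs with h
  · rfl
  · rw [notMem_support_iff.mp h, Complex.zero_re]

theorem coeff_imPart (p : MvPolynomial (Fin n) ℂ) (m : Fin n ⊕ Fin n →₀ ℕ) :
    coeff m (imPart p) = (coeff m (substXY p)).im := by
  classical
  simp only [imPart, coeff_sum, coeff_monomial, Finset.sum_ite_eq']
  split_ifs with h
  · rfl
  · rw [notMem_support_iff.mp h, Complex.zero_im]

/-- The polynomial `A + i B` with complex coefficients. -/
noncomputable def complexify (A B : RealPoly n) : MvPolynomial (Fin n ⊕ Fin n) ℂ :=
  map Complex.ofRealHom A + C Complex.I * map Complex.ofRealHom B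

theorem coeff_complexify (A B : RealPoly n) (m : Fin n ⊕ Fin n →₀ ℕ) :
    coeff m (complexify A B) = ((coeff m A : ℝ) : ℂ) + Complex.I * ((coeff m B : ℝ) : ℂ) := by
  simp [complexify, coeff_C_mul, coeff_map]

theorem complexify_rePart_imPart (p : MvPolynomial (Fin n) ℂ) :
    complexify (rePart p) (imPart p) = substXY p := by
  ext m
  rw [coeff_complexify, coeff_rePart, coeff_imPart]
  apply Complex.ext <;> simp

/-- Uniqueness of the decomposition `A + iB`; the sum, product and constant rules below all reduce
to it. -/
theorem rePart_imPart_of_substXY_eq {p : MvPolynomial (Fin n) ℂ} {A B : RealPoly n}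
    (h : substXY p = complexify A B) : rePart p = A ∧ imPart p = B := by
  constructor <;> ext m
  · rw [coeff_rePart, h, coeff_complexify]; simp
  · rw [coeff_imPart, h, coeff_complexify]; simp

theorem substXY_add (p q : MvPolynomial (Fin n) ℂ) :
    substXY (p + q) = substXY p + substXY q := by
  simp only [substXY, map_add]

theorem substXY_mul (p q : MvPolynomial (Fin n) ℂ) :
    substXY (p * q) = substXY p * substXY q := by
  simp only [substXY, map_mul]

theorem rePart_imPart_add (p q : MvPolynomial (Fin n) ℂ) :
    rePart (p + q) = rePart p + rePart q ∧ imPart (p + q) = imPart p + imPart q := by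
  apply rePart_imPart_of_substXY_eq
  rw [substXY_add, ← complexify_rePart_imPart p, ← complexify_rePart_imPart q]
  simp only [complexify, map_add]
  ring

theorem rePart_imPart_mul (p q : MvPolynomial (Fin n) ℂ) :
    rePart (p * q) = rePart p * rePart q - imPart p * imPart q ∧
      imPart (p * q) = rePart p * imPart q + imPart p * rePart q := by
  apply rePart_imPart_of_substXY_eq
  rw [substXY_mul, ← complexify_rePart_imPart p, ← complexify_rePart_imPart q]
  simp only [complexify, map_add, map_sub, map_mul]
  have hI : (C Complex.I : MvPolynomial (Fin n ⊕ Fin n) ℂ) * C Complex.I = -1 := by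
    rw [← C_mul, Complex.I_mul_I]; simp
  linear_combination
    (map Complex.ofRealHom (imPart p) * map Complex.ofRealHom (imPart q)) * hI

theorem rePart_imPart_C (c : ℂ) :
    rePart (C c : MvPolynomial (Fin n) ℂ) = C c.re ∧
      imPart (C c : MvPolynomial (Fin n) ℂ) = C c.im := by
  apply rePart_imPart_of_substXY_eq
  simp only [substXY, complexify, map_C, aeval_C, Complex.ofRealHom_eq_coe, ← C_mul, ← C_add,
    algebraMap_eq]
  congr 1
  apply Complex.ext <;> simp

/-- The real part as an additive map. -/
noncomputable def rePartHom : MvPolynomial (Fin n) ℂ →+ RealPoly n :=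
  AddMonoidHom.mk' rePart fun p q => (rePart_imPart_add p q).1

/-- The imaginary part as an additive map. -/
noncomputable def imPartHom : MvPolynomial (Fin n) ℂ →+ RealPoly n :=
  AddMonoidHom.mk' imPart fun p q => (rePart_imPart_add p q).2

theorem rePart_C_ofReal_mul (x : ℝ) (p : MvPolynomial (Fin n) ℂ) :
    rePart (C (x : ℂ) * p) = C x * rePart p := by
  rw [(rePart_imPart_mul _ _).1, (rePart_imPart_C _).1, (rePart_imPart_C _).2]; simp

theorem imPart_C_ofReal_mul (x : ℝ) (p : MvPolynomial (Fin n) ℂ) :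
    imPart (C (x : ℂ) * p) = C x * imPart p := by
  rw [(rePart_imPart_mul _ _).2, (rePart_imPart_C _).1, (rePart_imPart_C _).2]; simp

/-- Each variable is replaced by a linear form. -/
theorem totalDegree_substXY_le (p : MvPolynomial (Fin n) ℂ) :
    (substXY p).totalDegree ≤ p.totalDegree := by
  rw [substXY, aeval_def, eval₂_eq]
  refine totalDegree_finsetSum_le fun d hd => ?_
  refine (totalDegree_mul _ _).trans ?_
  rw [algebraMap_eq, totalDegree_C, zero_add]
  refine (totalDegree_finsetProd _ _).trans (le_trans ?_ (le_totalDegree hd))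
  refine Finset.sum_le_sum fun i _ => (totalDegree_pow _ _).trans ?_
  refine (Nat.mul_le_mul_left _ ?_).trans (mul_one _).le
  refine (totalDegree_add _ _).trans (max_le (totalDegree_X _).le ?_)
  refine (totalDegree_mul _ _).trans ?_
  rw [totalDegree_C, totalDegree_X, zero_add]

theorem totalDegree_rePart_le (p : MvPolynomial (Fin n) ℂ) :
    (rePart p).totalDegree ≤ p.totalDegree := by
  refine (Finset.sup_mono fun m hm => ?_).trans (totalDegree_substXY_le p)
  rw [mem_support_iff, coeff_rePart] at hm
  rw [mem_support_iff]
  intro h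
  simp [h] at hm

theorem totalDegree_imPart_le (p : MvPolynomial (Fin n) ℂ) :
    (imPart p).totalDegree ≤ p.totalDegree := by
  refine (Finset.sup_mono fun m hm => ?_).trans (totalDegree_substXY_le p)
  rw [mem_support_iff, coeff_imPart] at hm
  rw [mem_support_iff]
  intro h
  simp [h] at hm

/-- The polynomial `(p^re)² + (p^im)²`. -/
noncomputable def normSqPoly (p : MvPolynomial (Fin n) ℂ) : RealPoly n := rePart p ^ 2 + imPart p ^ 2

theorem normSqPoly_mul (p q : MvPolynomial (Fin n) ℂ) :
    normSqPoly (p * q) = normSqPoly p * normSqPoly q := by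
  simp only [normSqPoly, rePart_imPart_mul]
  ring

theorem normSqPoly_C (c : ℂ) :
    normSqPoly (C c : MvPolynomial (Fin n) ℂ) = C (‖c‖ ^ 2) := by
  rw [normSqPoly, (rePart_imPart_C c).1, (rePart_imPart_C c).2, ← Complex.normSq_eq_norm_sq,
    Complex.normSq_apply, C_add, C_mul, C_mul]
  ring

theorem totalDegree_normSqPoly_le (p : MvPolynomial (Fin n) ℂ) :
    (normSqPoly p).totalDegree ≤ 2 * p.totalDegree := by
  refine (totalDegree_add _ _).trans (max_le ?_ ?_) <;> refine (totalDegree_pow _ _).trans ?_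
  · exact Nat.mul_le_mul_left _ (totalDegree_rePart_le p)
  · exact Nat.mul_le_mul_left _ (totalDegree_imPart_le p)

theorem monomialGen_eq (b : Fin n →₀ ℕ) : monomialGen b = normSqPoly (monomial b 1) - 1 := rfl

theorem totalDegree_normSqPoly_monomial_le (b : Fin n →₀ ℕ) (c : ℂ) :
    (normSqPoly (monomial b c)).totalDegree ≤ 2 * b.degree :=
  (totalDegree_normSqPoly_le _).trans (Nat.mul_le_mul_left _ (totalDegree_monomial_le _ _))

theorem totalDegree_monomialGen_le (b : Fin n →₀ ℕ) :
    (monomialGen b).totalDegree ≤ 2 * b.degree := by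
  rw [monomialGen_eq]
  refine (totalDegree_sub _ _).trans (max_le (totalDegree_normSqPoly_monomial_le b 1) ?_)
  rw [totalDegree_one]
  exact Nat.zero_le _

end RealImaginaryParts

/-! ### Monomial generators and the monoid of exponents. -/

section Generators

variable {n : ℕ}

theorem monomialGen_zero : monomialGen (0 : Fin n →₀ ℕ) = 0 := by
  have := normSqPoly_C (n := n) 1
  rw [monomialGen_eq, ← C_apply, this]; simp

/-- Telescoping of `|Z^b|² |Z^c|² - 1`. Both summands stay within twice the degree of `b + c`, so
iteration loses nothing in the degree. -/
theorem monomialGen_add (b c : Fin n →₀ ℕ) :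
    monomialGen (b + c) = monomialGen b + normSqPoly (monomial b 1) * monomialGen c := by
  have : (monomial (b + c) (1 : ℂ)) = monomial b 1 * monomial c 1 := by
    rw [monomial_mul, one_mul]
  rw [monomialGen_eq, monomialGen_eq, monomialGen_eq, this, normSqPoly_mul]
  ring

/-- The generator of an exponent in the monoid spanned by `s` is a combination, without cancellation
of degrees, of the generators of the elements of `s`. -/
theorem exists_monomialGen_eq_sum (s : Finset (Fin n →₀ ℕ)) {b : Fin n →₀ ℕ}
    (hb : b ∈ AddSubmonoid.closure (s : Set (Fin n →₀ ℕ))) :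
    ∃ M : (Fin n →₀ ℕ) → RealPoly n, monomialGen b = ∑ c ∈ s, monomialGen c * M c ∧
      ∀ c ∈ s, (monomialGen c * M c).totalDegree ≤ 2 * b.degree := by
  classical
  induction hb using AddSubmonoid.closure_induction with
  | mem x hx =>
    refine ⟨fun c => if c = x then 1 else 0, ?_, fun c _ => ?_⟩
    · simp only [mul_ite, mul_one, mul_zero, Finset.sum_ite_eq']
      rw [if_pos (Finset.mem_coe.mp hx)]
    · dsimp only
      split_ifs with h
      · rw [mul_one, h]; exact totalDegree_monomialGen_le x
      · simp
  | zero => exact ⟨fun _ => 0, by simp [monomialGen_zero], by simp⟩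
  | add x y _ _ hx hy =>
    obtain ⟨M, hM, hMd⟩ := hx
    obtain ⟨N, hN, hNd⟩ := hy
    refine ⟨fun c => M c + normSqPoly (monomial x 1) * N c, ?_, fun c hc => ?_⟩
    · rw [monomialGen_add, hM, hN, Finset.mul_sum, ← Finset.sum_add_distrib]
      exact Finset.sum_congr rfl fun c _ => by ring
    · have h1 : monomialGen c * (M c + normSqPoly (monomial x 1) * N c) =
          monomialGen c * M c + normSqPoly (monomial x 1) * (monomialGen c * N c) := by ring
      rw [h1, map_add, mul_add]
      refine (totalDegree_add _ _).trans (max_le ((hMd c hc).trans (Nat.le_add_right _ _)) ?_)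
      exact (totalDegree_mul _ _).trans
        (Nat.add_le_add (totalDegree_normSqPoly_monomial_le x 1) (hNd c hc))

theorem support_mul_subset_closure {p q : MvPolynomial (Fin n) ℂ}
    (S : AddSubmonoid (Fin n →₀ ℕ)) (hp : (p.support : Set (Fin n →₀ ℕ)) ⊆ S)
    (hq : (q.support : Set (Fin n →₀ ℕ)) ⊆ S) :
    ((p * q).support : Set (Fin n →₀ ℕ)) ⊆ S := by
  classical
  intro b hb
  obtain ⟨x, hx, y, hy, rfl⟩ := Finset.mem_add.mp (support_mul p q hb)
  exact S.add_mem (hp hx) (hq hy)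

theorem support_prod_subset_closure {ι : Type*} (t : Finset ι) (p : ι → MvPolynomial (Fin n) ℂ)
    (S : AddSubmonoid (Fin n →₀ ℕ)) (hp : ∀ i ∈ t, ((p i).support : Set (Fin n →₀ ℕ)) ⊆ S) :
    ((∏ i ∈ t, p i).support : Set (Fin n →₀ ℕ)) ⊆ S := by
  classical
  induction t using Finset.induction_on with
  | empty =>
    intro b hb
    have : b = 0 := by
      by_contra h
      rw [Finset.prod_empty, Finset.mem_coe, mem_support_iff, coeff_one, if_neg (Ne.symm h)] at hb
      exact hb rfl
    rw [this]; exact S.zero_mem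
  | insert i t hi ih =>
    rw [Finset.prod_insert hi]
    exact support_mul_subset_closure S (hp i (Finset.mem_insert_self i t))
      (ih fun k hk => hp k (Finset.mem_insert_of_mem hk))

end Generators

/-! ### Lagrange's identity, the explicit certificate, and its transfer to a factor. -/

section Certificates

variable {n : ℕ}

/-- Lagrange-type identity for weighted sums of squares of differences. -/
theorem sum_offDiag_mul_sub_sq {ι R : Type*} [CommRing R] [DecidableEq ι] (S : Finset ι)
    (s p : ι → R) :
    ∑ x ∈ S.offDiag, s x.1 * s x.2 * (p x.1 - p x.2) ^ 2 =
      2 * ((∑ b ∈ S, s b) * ∑ b ∈ S, s b * p b ^ 2) - 2 * (∑ b ∈ S, s b * p b) ^ 2 := by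
  have h : ∑ x ∈ S.offDiag, s x.1 * s x.2 * (p x.1 - p x.2) ^ 2 =
      ∑ x ∈ S ×ˢ S, s x.1 * s x.2 * (p x.1 - p x.2) ^ 2 := by
    -- The diagonal contributes zero, so the sum may run over the full square and be separated into
    -- products.
    rw [← Finset.diag_union_offDiag S, Finset.sum_union (Finset.disjoint_diag_offDiag S)]
    rw [Finset.sum_diag]
    simp
  rw [h, Finset.sum_product]
  have h2 : ∀ x ∈ S, ∑ y ∈ S, s x * s y * (p x - p y) ^ 2 =
      (s x * p x ^ 2) * (∑ y ∈ S, s y) + s x * (∑ y ∈ S, s y * p y ^ 2)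
        - 2 * (s x * p x) * ∑ y ∈ S, s y * p y := by
    intro x _
    simp only [Finset.mul_sum, ← Finset.sum_add_distrib, ← Finset.sum_sub_distrib]
    exact Finset.sum_congr rfl fun y _ => by ring
  rw [Finset.sum_congr rfl h2, Finset.sum_sub_distrib, Finset.sum_add_distrib, ← Finset.sum_mul,
    ← Finset.sum_mul, ← Finset.sum_mul, ← Finset.mul_sum]
  ring

theorem term_eq_C_mul_unitTerm (h : MvPolynomial (Fin n) ℂ) (b : Fin n →₀ ℕ) :
    term h b = C (‖coeff b h‖ : ℂ) * unitTerm h b := by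
  rw [term, unitTerm, C_mul_monomial]
  by_cases hb : coeff b h = 0
  · simp [hb]
  · rw [mul_div_cancel₀]
    simpa using hb

theorem normSqPoly_unitTerm (h : MvPolynomial (Fin n) ℂ) {b : Fin n →₀ ℕ} (hb : b ∈ h.support) :
    normSqPoly (unitTerm h b) = normSqPoly (monomial b 1) := by
  have hb' : ‖coeff b h‖ ≠ 0 := by simpa using hb
  have : unitTerm h b = C (coeff b h / (‖coeff b h‖ : ℂ)) * monomial b 1 := by
    rw [unitTerm, C_mul_monomial, mul_one]
  rw [this, normSqPoly_mul, normSqPoly_C, norm_div, Complex.norm_real, norm_norm, div_self hb']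
  simp

/-- A nonnegative constant is the square of its real root. -/
theorem isSumSq_C_mul {x : ℝ} (hx : 0 ≤ x) {p : RealPoly n} (hp : IsSumSq p) :
    IsSumSq (C x * p) := by
  refine IsSumSq.mul ?_ hp
  rw [← Real.mul_self_sqrt hx, C_mul]
  exact IsSumSq.mul_self _

theorem gap_pos {h : MvPolynomial (Fin n) ℂ} {a : Fin n →₀ ℕ}
    (ha : IsDominant h 0 a) : 0 < gap h a := by
  have h2 := ha.2
  simp only [termAbs, Pi.zero_apply, Real.exp_zero, one_pow, Finset.prod_const_one, mul_one] at h2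
  rw [gap, sub_pos]
  exact pow_lt_pow_left₀ h2 (Finset.sum_nonneg fun _ _ => norm_nonneg _) two_ne_zero

theorem rePart_sum_term (h : MvPolynomial (Fin n) ℂ) (S : Finset (Fin n →₀ ℕ)) :
    rePart (∑ b ∈ S, term h b) = ∑ b ∈ S, C ‖coeff b h‖ * rePart (unitTerm h b) :=
  (map_sum rePartHom _ _).trans <| Finset.sum_congr rfl fun b _ => by
    rw [← rePart_C_ofReal_mul, ← term_eq_C_mul_unitTerm]; rfl

theorem imPart_sum_term (h : MvPolynomial (Fin n) ℂ) (S : Finset (Fin n →₀ ℕ)) :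
    imPart (∑ b ∈ S, term h b) = ∑ b ∈ S, C ‖coeff b h‖ * imPart (unitTerm h b) :=
  (map_sum imPartHom _ _).trans <| Finset.sum_congr rfl fun b _ => by
    rw [← imPart_C_ofReal_mul, ← term_eq_C_mul_unitTerm]; rfl

theorem sum_term (h : MvPolynomial (Fin n) ℂ) : ∑ b ∈ h.support, term h b = h :=
  (as_sum h).symm

theorem rePart_neg (p : MvPolynomial (Fin n) ℂ) : rePart (-p) = -rePart p := map_neg rePartHom p

theorem imPart_neg (p : MvPolynomial (Fin n) ℂ) : imPart (-p) = -imPart p := map_neg imPartHom p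

theorem rePart_term (h : MvPolynomial (Fin n) ℂ) (b : Fin n →₀ ℕ) :
    rePart (term h b) = C ‖coeff b h‖ * rePart (unitTerm h b) := by
  rw [term_eq_C_mul_unitTerm, rePart_C_ofReal_mul]

theorem imPart_term (h : MvPolynomial (Fin n) ℂ) (b : Fin n →₀ ℕ) :
    imPart (term h b) = C ‖coeff b h‖ * imPart (unitTerm h b) := by
  rw [term_eq_C_mul_unitTerm, imPart_C_ofReal_mul]

theorem lopsidedCertificate_identity {h : MvPolynomial (Fin n) ℂ} {a : Fin n →₀ ℕ}
    (ha : IsDominant h 0 a) :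
    (∑ b ∈ h.support, monomialGen b * (lopsidedCertificate h a).monMult b)
      + rePart h * (lopsidedCertificate h a).reMult + imPart h * (lopsidedCertificate h a).imMult
      + (lopsidedCertificate h a).sos + 1 = 0 := by
  classical
  have hκ := (gap_pos ha).ne'
  set S := h.support.erase a with hS
  set s : (Fin n →₀ ℕ) → RealPoly n := fun b => C ‖coeff b h‖ with hs
  set p : (Fin n →₀ ℕ) → RealPoly n := fun b => rePart (unitTerm h b) with hp
  set q : (Fin n →₀ ℕ) → RealPoly n := fun b => imPart (unitTerm h b) with hq
  set k : RealPoly n := C (gap h a)⁻¹ with hk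
  -- On the support, `unitTerm h b` differs from `Z^b` by a unimodular factor, so it gives the same
  -- generator.
  have hgen : ∀ b ∈ h.support, monomialGen b = p b ^ 2 + q b ^ 2 - 1 := fun b hb => by
    rw [monomialGen_eq, ← normSqPoly_unitTerm h hb, normSqPoly]
  have hsum : ∑ b ∈ h.support, monomialGen b * (lopsidedCertificate h a).monMult b =
      (p a ^ 2 + q a ^ 2 - 1) * (k * s a ^ 2) +
        ∑ b ∈ S, (p b ^ 2 + q b ^ 2 - 1) * (k * (-s b * ∑ c ∈ S, s c)) := by
    rw [← Finset.add_sum_erase _ _ ha.1]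
    refine congrArg₂ (· + ·) ?_ ?_
    · rw [hgen a ha.1]
      simp [lopsidedCertificate, hk, hs]
    · refine Finset.sum_congr rfl fun b hb => ?_
      rw [hgen b (Finset.mem_of_mem_erase hb)]
      simp [lopsidedCertificate, hk, hs, Finset.ne_of_mem_erase hb, hS]
  have hh : h = term h a + ∑ b ∈ S, term h b := by
    rw [hS, Finset.add_sum_erase _ _ ha.1, sum_term]
  have hre : rePart h = s a * p a + ∑ b ∈ S, s b * p b := by
    conv_lhs => rw [hh]
    rw [(rePart_imPart_add _ _).1, rePart_sum_term, rePart_term]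
  have him : imPart h = s a * q a + ∑ b ∈ S, s b * q b := by
    conv_lhs => rw [hh]
    rw [(rePart_imPart_add _ _).2, imPart_sum_term, imPart_term]
  have hreM : (lopsidedCertificate h a).reMult = k * (-(s a * p a) + ∑ b ∈ S, s b * p b) := by
    simp only [lopsidedCertificate]
    rw [(rePart_imPart_add _ _).1, rePart_sum_term, rePart_neg, rePart_term]
  have himM : (lopsidedCertificate h a).imMult = k * (-(s a * q a) + ∑ b ∈ S, s b * q b) := by
    simp only [lopsidedCertificate]
    rw [(rePart_imPart_add _ _).2, imPart_sum_term, imPart_neg, imPart_term]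
  have hsos : (lopsidedCertificate h a).sos =
      k * ((∑ b ∈ S, s b) * ∑ b ∈ S, s b * p b ^ 2 - (∑ b ∈ S, s b * p b) ^ 2) +
      k * ((∑ b ∈ S, s b) * ∑ b ∈ S, s b * q b ^ 2 - (∑ b ∈ S, s b * q b) ^ 2) := by
    have h1 : (lopsidedCertificate h a).sos = C ((gap h a)⁻¹ / 2) *
        (∑ x ∈ S.offDiag, s x.1 * s x.2 * (p x.1 - p x.2) ^ 2 +
          ∑ x ∈ S.offDiag, s x.1 * s x.2 * (q x.1 - q x.2) ^ 2) := by
      simp only [lopsidedCertificate, C_mul, mul_add, Finset.sum_add_distrib, hs, hp, hq, hS]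
    -- Ordered pairs give Lagrange's identity with a factor 2, which the `1/2` absorbs.
    have h2 : (C ((gap h a)⁻¹ / 2) : RealPoly n) * 2 = k := by
      rw [hk, show (2 : RealPoly n) = C 2 from (map_ofNat C 2).symm, ← C_mul]
      congr 1; ring
    rw [h1, sum_offDiag_mul_sub_sq, sum_offDiag_mul_sub_sq, ← h2]
    ring
  have hone : k * (s a ^ 2 - (∑ b ∈ S, s b) ^ 2) = 1 := by
    have : s a ^ 2 - (∑ b ∈ S, s b) ^ 2 = C (gap h a) := by
      simp only [gap, hs, C_sub, C_pow, map_sum, hS]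
    rw [this, hk, ← C_mul, inv_mul_cancel₀ hκ, C_1]
  have hS2 : ∑ b ∈ S, (p b ^ 2 + q b ^ 2 - 1) * (k * (-s b * ∑ c ∈ S, s c)) =
      -(k * (∑ c ∈ S, s c)) * (∑ b ∈ S, s b * p b ^ 2 + ∑ b ∈ S, s b * q b ^ 2
        - ∑ b ∈ S, s b) := by
    rw [← Finset.sum_add_distrib, ← Finset.sum_sub_distrib, Finset.mul_sum]
    exact Finset.sum_congr rfl fun b _ => by ring
  rw [hsum, hS2, hre, him, hreM, himM, hsos]
  linear_combination -hone

theorem isSumSq_lopsidedCertificate_sos {h : MvPolynomial (Fin n) ℂ} {a : Fin n →₀ ℕ}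
    (ha : IsDominant h 0 a) : IsSumSq (lopsidedCertificate h a).sos := by
  refine isSumSq_C_mul (by have := gap_pos ha; positivity) ?_
  refine IsSumSq.sum fun x _ => isSumSq_C_mul (by positivity) ?_
  exact IsSumSq.add (IsSquare.isSumSq (IsSquare.sq _)) (IsSquare.isSumSq (IsSquare.sq _))

theorem totalDegree_term_le (h : MvPolynomial (Fin n) ℂ) (b : Fin n →₀ ℕ) :
    (term h b).totalDegree ≤ h.totalDegree := by
  by_cases hb : coeff b h = 0
  · simp [term, hb]
  · exact (totalDegree_monomial_le _ _).trans (le_totalDegree (mem_support_iff.mpr hb))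

theorem totalDegree_C_mul_le (x : ℝ) (p : RealPoly n) :
    (C x * p).totalDegree ≤ p.totalDegree := by
  refine (totalDegree_mul _ _).trans ?_
  rw [totalDegree_C, zero_add]

theorem totalDegree_lopsided_multiplier_le (h : MvPolynomial (Fin n) ℂ) (a : Fin n →₀ ℕ) :
    (-term h a + ∑ b ∈ h.support.erase a, term h b).totalDegree ≤ h.totalDegree := by
  refine (totalDegree_add _ _).trans (max_le ?_ ?_)
  · rw [totalDegree_neg]; exact totalDegree_term_le h a
  · exact totalDegree_finsetSum_le fun b _ => totalDegree_term_le h b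

theorem totalDegree_lopsidedCertificate_reMult_le (h : MvPolynomial (Fin n) ℂ)
    (a : Fin n →₀ ℕ) : (lopsidedCertificate h a).reMult.totalDegree ≤ h.totalDegree :=
  (totalDegree_C_mul_le _ _).trans
    ((totalDegree_rePart_le _).trans (totalDegree_lopsided_multiplier_le h a))

theorem totalDegree_lopsidedCertificate_imMult_le (h : MvPolynomial (Fin n) ℂ)
    (a : Fin n →₀ ℕ) : (lopsidedCertificate h a).imMult.totalDegree ≤ h.totalDegree :=
  (totalDegree_C_mul_le _ _).trans
    ((totalDegree_imPart_le _).trans (totalDegree_lopsided_multiplier_le h a))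

/-- Constancy of these multipliers lets the generators be rewritten in `Certificate.IsValid.of_mul`
without raising the degree. -/
theorem lopsidedCertificate_monMult_eq_C (h : MvPolynomial (Fin n) ℂ) (a b : Fin n →₀ ℕ) :
    ∃ x : ℝ, (lopsidedCertificate h a).monMult b = C x := by
  simp only [lopsidedCertificate]
  split_ifs
  exacts [⟨_, rfl⟩, ⟨_, rfl⟩]

theorem totalDegree_lopsidedCertificate_sos_le (h : MvPolynomial (Fin n) ℂ) (a : Fin n →₀ ℕ) :
    (lopsidedCertificate h a).sos.totalDegree ≤ 2 * h.totalDegree := by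
  have hu : ∀ b ∈ h.support, (unitTerm h b).totalDegree ≤ h.totalDegree := fun b hb =>
    (totalDegree_monomial_le _ _).trans (le_totalDegree hb)
  refine (totalDegree_C_mul_le _ _).trans (totalDegree_finsetSum_le fun x hx => ?_)
  obtain ⟨h1, h2, -⟩ := Finset.mem_offDiag.mp hx
  have h1 := hu _ (Finset.mem_of_mem_erase h1)
  have h2 := hu _ (Finset.mem_of_mem_erase h2)
  refine (totalDegree_C_mul_le _ _).trans ((totalDegree_add _ _).trans (max_le ?_ ?_)) <;>
    refine (totalDegree_pow _ _).trans (Nat.mul_le_mul_left _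
      ((totalDegree_sub _ _).trans (max_le ?_ ?_)))
  exacts [(totalDegree_rePart_le _).trans h1, (totalDegree_rePart_le _).trans h2,
    (totalDegree_imPart_le _).trans h1, (totalDegree_imPart_le _).trans h2]

theorem lopsidedCertificate_isValid {h : MvPolynomial (Fin n) ℂ} {a : Fin n →₀ ℕ}
    (ha : IsDominant h 0 a) : (lopsidedCertificate h a).IsValid h (2 * h.totalDegree) := by
  refine ⟨lopsidedCertificate_identity ha, isSumSq_lopsidedCertificate_sos ha, fun b hb => ?_,
    ?_, ?_, totalDegree_lopsidedCertificate_sos_le h a⟩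
  · obtain ⟨x, hx⟩ := lopsidedCertificate_monMult_eq_C h a b
    rw [hx, mul_comm]
    exact (totalDegree_C_mul_le _ _).trans ((totalDegree_monomialGen_le b).trans
      (Nat.mul_le_mul_left _ (le_totalDegree hb)))
  · rw [two_mul]
    exact (totalDegree_mul _ _).trans (Nat.add_le_add (totalDegree_rePart_le h)
      (totalDegree_lopsidedCertificate_reMult_le h a))
  · rw [two_mul]
    exact (totalDegree_mul _ _).trans (Nat.add_le_add (totalDegree_imPart_le h)
      (totalDegree_lopsidedCertificate_imMult_le h a))

theorem Certificate.IsValid.mono {K : Certificate n} {h : MvPolynomial (Fin n) ℂ} {D E : ℕ}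
    (hK : K.IsValid h D) (hDE : D ≤ E) : K.IsValid h E :=
  ⟨hK.1, hK.2.1, fun b hb => (hK.2.2.1 b hb).trans hDE, hK.2.2.2.1.trans hDE,
    hK.2.2.2.2.1.trans hDE, hK.2.2.2.2.2.trans hDE⟩

/-- A certificate for a multiple of `g` with constant multipliers of the monomial generators yields
a certificate for `g` with the same sum of squares. -/
theorem Certificate.IsValid.of_mul {K : Certificate n} {g q : MvPolynomial (Fin n) ℂ} {D d : ℕ}
    (hK : K.IsValid (g * q) D) (hmon : ∀ b, ∃ x : ℝ, K.monMult b = C x)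
    (hre : K.reMult.totalDegree ≤ d) (him : K.imMult.totalDegree ≤ d)
    (hD : g.totalDegree + (d + q.totalDegree) ≤ D) (hd : 2 * (g * q).totalDegree ≤ D)
    (hsupp : ((g * q).support : Set (Fin n →₀ ℕ)) ⊆
      AddSubmonoid.closure (g.support : Set (Fin n →₀ ℕ))) :
    ∃ K' : Certificate n, K'.IsValid g D ∧ K'.sos = K.sos := by
  choose x hx using hmon
  choose M hM hMd using fun b : (g * q).support =>
    exists_monomialGen_eq_sum g.support (hsupp b.2)
  -- The last two multipliers come from `(K_re - i K_im) q = K'_re - i K'_im`, that is, from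
  -- collecting `g^re` and `g^im` after expanding the product.
  refine ⟨{ monMult := fun c => ∑ b : (g * q).support, C (x b) * M b c
            reMult := K.reMult * rePart q + K.imMult * imPart q
            imMult := K.imMult * rePart q - K.reMult * imPart q
            sos := K.sos }, ⟨?_, hK.2.1, fun c hc => ?_, ?_, ?_, hK.2.2.2.2.2⟩, rfl⟩
  · have h1 : ∑ c ∈ g.support, monomialGen c * ∑ b : (g * q).support, C (x b) * M b c =
        ∑ b ∈ (g * q).support, monomialGen b * K.monMult b := by
      rw [← Finset.sum_coe_sort (g * q).support]
      simp only [Finset.mul_sum]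
      rw [Finset.sum_comm]
      refine Finset.sum_congr rfl fun b _ => ?_
      rw [hM b, hx, Finset.sum_mul]
      exact Finset.sum_congr rfl fun c _ => by ring
    have h2 := hK.1
    rw [(rePart_imPart_mul g q).1, (rePart_imPart_mul g q).2] at h2
    dsimp only
    rw [h1]
    linear_combination h2
  · dsimp only
    rw [Finset.mul_sum]
    refine totalDegree_finsetSum_le fun b _ => ?_
    rw [mul_left_comm]
    exact (totalDegree_C_mul_le _ _).trans ((hMd b c hc).trans
      ((Nat.mul_le_mul_left _ (le_totalDegree b.2)).trans hd))
  · refine ((totalDegree_mul _ _).trans (Nat.add_le_add (totalDegree_rePart_le g)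
      ((totalDegree_add _ _).trans (max_le ?_ ?_)))).trans hD
    · exact (totalDegree_mul _ _).trans (Nat.add_le_add hre (totalDegree_rePart_le q))
    · exact (totalDegree_mul _ _).trans (Nat.add_le_add him (totalDegree_imPart_le q))
  · refine ((totalDegree_mul _ _).trans (Nat.add_le_add (totalDegree_imPart_le g)
      ((totalDegree_sub _ _).trans (max_le ?_ ?_)))).trans hD
    · exact (totalDegree_mul _ _).trans (Nat.add_le_add him (totalDegree_rePart_le q))
    · exact (totalDegree_mul _ _).trans (Nat.add_le_add hre (totalDegree_imPart_le q))

theorem coeff_zero_lopsidedCertificate_monMult_pos_iff {h : MvPolynomial (Fin n) ℂ}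
    {a : Fin n →₀ ℕ} (ha : IsDominant h 0 a) (b : Fin n →₀ ℕ) :
    0 < coeff 0 ((lopsidedCertificate h a).monMult b) ↔ b = a := by
  have hκ := gap_pos ha
  simp only [lopsidedCertificate]
  split_ifs with hb
  · have : ‖coeff a h‖ ≠ 0 := by simpa using ha.1
    simp only [coeff_zero_C, hb, iff_true]
    positivity
  · simp only [coeff_zero_C, hb, iff_false, not_lt]
    refine mul_nonpos_of_nonneg_of_nonpos (inv_nonneg.mpr hκ.le)
      (mul_nonpos_of_nonpos_of_nonneg (neg_nonpos.mpr (norm_nonneg _)) ?_)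
    exact Finset.sum_nonneg fun _ _ => norm_nonneg _

end Certificates

end Amoeba

namespace Amoeba

/-! ### Logarithmic integrals along closed curves and Rouché's theorem. -/

section LogarithmicIntegrals

/-- The integral of the logarithmic derivative of a closed nonvanishing curve is a multiple of
`2πi`. -/
theorem exists_int_integral_div_eq {γ γ' : ℝ → ℂ} {a b : ℝ} (hγ : ∀ t, HasDerivAt γ (γ' t) t)
    (hγ' : Continuous γ') (h0 : ∀ t, γ t ≠ 0) (hab : γ a = γ b) :
    ∃ m : ℤ, ∫ t in a..b, γ' t / γ t = m * (2 * Real.pi * Complex.I) := by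
  have hc : Continuous fun t => γ' t / γ t :=
    hγ'.div (continuous_iff_continuousAt.mpr fun t => (hγ t).continuousAt) h0
  rw [← Complex.exp_eq_one_iff]
  set E : ℝ → ℂ := fun t => ∫ s in a..t, γ' s / γ s with hE
  have hEd : ∀ t, HasDerivAt E (γ' t / γ t) t := fun t =>
    intervalIntegral.integral_hasDerivAt_right (hc.intervalIntegrable _ _)
      (hc.stronglyMeasurableAtFilter _ _) hc.continuousAt
  -- `γ exp(-E)` is constant; comparing its values at the endpoints of the closed curve gives `exp
  -- (E b) = 1`.
  have hd : ∀ t, HasDerivAt (fun t => γ t * Complex.exp (-E t)) 0 t := fun t => by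
    have h1 := (hγ t).mul (hEd t).neg.cexp
    refine h1.congr_deriv ?_
    have := h0 t
    field_simp
    ring
  have hconst := is_const_of_deriv_eq_zero (fun t => (hd t).differentiableAt)
    (fun t => (hd t).deriv) a b
  have hEa : E a = 0 := intervalIntegral.integral_same
  simp only [hEa, neg_zero, Complex.exp_zero, mul_one, hab] at hconst
  have h2 : Complex.exp (-E b) = 1 := (mul_right_eq_self₀.mp hconst.symm).resolve_right (h0 b)
  have h3 : Complex.exp (E b) * Complex.exp (-E b) = 1 := by
    rw [← Complex.exp_add, add_neg_cancel, Complex.exp_zero]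
  rwa [h2, mul_one] at h3

/-- Rouché's theorem for logarithmic integrals along closed curves. -/
theorem integral_div_eq_of_norm_sub_lt {γ γ' δ δ' : ℝ → ℂ} {a b : ℝ}
    (hγ : ∀ t, HasDerivAt γ (γ' t) t) (hδ : ∀ t, HasDerivAt δ (δ' t) t)
    (hγ' : Continuous γ') (hδ' : Continuous δ') (hlt : ∀ t, ‖γ t - δ t‖ < ‖δ t‖)
    (hγab : γ a = γ b) (hδab : δ a = δ b) :
    ∫ t in a..b, γ' t / γ t = ∫ t in a..b, δ' t / δ t := by
  have hδ0 : ∀ t, δ t ≠ 0 := fun t h => by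
    have := hlt t
    rw [h, norm_zero] at this
    exact absurd this (norm_nonneg _).not_gt
  have hγ0 : ∀ t, γ t ≠ 0 := fun t h => by
    have := hlt t
    rw [h, zero_sub, norm_neg] at this
    exact lt_irrefl _ this
  have hγc : Continuous fun t => γ' t / γ t :=
    hγ'.div (continuous_iff_continuousAt.mpr fun t => (hγ t).continuousAt) hγ0
  have hδc : Continuous fun t => δ' t / δ t :=
    hδ'.div (continuous_iff_continuousAt.mpr fun t => (hδ t).continuousAt) hδ0
  -- The quotient stays in the unit disc around 1, so its principal logarithm is a global primitive
  -- of the difference of the integrands.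
  have hslit : ∀ t, γ t / δ t ∈ Complex.slitPlane := fun t => by
    have h1 : ‖γ t / δ t - 1‖ < 1 := by
      rw [div_sub_one (hδ0 t), norm_div, div_lt_one (norm_pos_iff.mpr (hδ0 t))]
      exact hlt t
    simpa using Complex.mem_slitPlane_of_norm_lt_one h1
  have hlog : ∀ t, HasDerivAt (fun t => Complex.log (γ t / δ t)) (γ' t / γ t - δ' t / δ t) t :=
    fun t => by
      refine (((hγ t).fun_div (hδ t) (hδ0 t)).clog_real (hslit t)).congr_deriv ?_
      have := hδ0 t
      have := hγ0 t
      field_simp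
  have hint := intervalIntegral.integral_eq_sub_of_hasDerivAt (a := a) (b := b)
    (fun t _ => hlog t) ((hγc.sub hδc).intervalIntegrable _ _)
  rw [intervalIntegral.integral_sub (hγc.intervalIntegrable _ _) (hδc.intervalIntegrable _ _),
    hγab, hδab, sub_self] at hint
  exact sub_eq_zero.mp hint

end LogarithmicIntegrals

/-! ### Fubini on the cube along one coordinate. -/

section TorusAverages

open MeasureTheory

theorem insertNth_add_single {m : ℕ} (j : Fin (m + 1)) (s t : ℝ) (y : Fin m → ℝ) :
    (j.insertNth s y : Fin (m + 1) → ℝ) + Pi.single j t = j.insertNth (s + t) y := by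
  ext i
  refine j.succAboveCases ?_ (fun k => ?_) i <;> simp

/-- A continuous function on the cube with constant integrals over the lines in one coordinate
direction. -/
theorem setIntegral_cube_eq_of_slices {m : ℕ} {F : (Fin (m + 1) → ℝ) → ℂ} (hF : Continuous F)
    (j : Fin (m + 1)) {T : ℝ} (hT : 0 ≤ T) {c : ℂ}
    (hc : ∀ θ : Fin (m + 1) → ℝ, ∫ t in 0..T, F (θ + Pi.single j t) = c) :
    ∫ θ in Set.Icc (0 : Fin (m + 1) → ℝ) (fun _ => T), F θ = (T : ℂ) ^ m * c := by
  set e : ℝ × (Fin m → ℝ) ≃ᵐ (Fin (m + 1) → ℝ) :=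
    (MeasurableEquiv.piFinSuccAbove (fun _ => ℝ) j).symm with he
  have hem : MeasurePreserving e :=
    (volume_preserving_piFinSuccAbove (fun _ : Fin (m + 1) => ℝ) j).symm _
  have hepre : (e ⁻¹' Set.Icc 0 fun _ => T) = Set.Icc 0 T ×ˢ Set.Icc (0 : Fin m → ℝ) fun _ => T :=
    ((Fin.insertNthOrderIso (fun _ => ℝ) j).preimage_Icc _ _).trans (Set.Icc_prod_eq _ _)
  have hei : ∀ p, e p = j.insertNth p.1 p.2 := fun p => rfl
  have hint : IntegrableOn F (Set.Icc (0 : Fin (m + 1) → ℝ) fun _ => T) :=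
    hF.continuousOn.integrableOn_Icc
  have hint' := hint
  rw [← hem.integrableOn_comp_preimage e.measurableEmbedding, hepre] at hint'
  -- Swapping the factors makes the `j`-th coordinate the inner variable, so that `hc` evaluates
  -- each slice.
  rw [← hem.map_eq, setIntegral_map_equiv, hepre, Measure.volume_eq_prod, ← setIntegral_prod_swap,
    setIntegral_prod]
  · have hslice : ∀ y : Fin m → ℝ, ∫ s in Set.Icc 0 T, F (e (Prod.swap (y, s))) = c := fun y => by
      rw [← hc (j.insertNth 0 y), intervalIntegral.integral_of_le hT, integral_Icc_eq_integral_Ioc]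
      simp only [insertNth_add_single, zero_add, hei, Prod.swap]
    simp only [hslice]
    rw [setIntegral_const, Measure.real, Real.volume_Icc_pi]
    simp [ENNReal.toReal_ofReal hT]
  · exact hint'.swap

end TorusAverages

/-! ### Winding numbers along coordinate circles and the order. -/

section WindingNumbers

variable {n : ℕ}

/-- The point of the torus over `u` with the arguments `θ`. -/
noncomputable def torusPoint (u θ : Fin n → ℝ) : Fin n → ℂ :=
  torusMap 0 (fun i => Real.exp (u i)) θ

theorem torusPoint_apply (u θ : Fin n → ℝ) (i : Fin n) :
    torusPoint u θ i = Real.exp (u i) * Complex.exp (θ i * Complex.I) := by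
  simp [torusPoint, torusMap]

theorem norm_torusPoint_apply (u θ : Fin n → ℝ) (i : Fin n) :
    ‖torusPoint u θ i‖ = Real.exp (u i) := by
  rw [torusPoint_apply, norm_mul, Complex.norm_exp_ofReal_mul_I, mul_one, Complex.norm_real,
    Real.norm_of_nonneg (Real.exp_pos _).le]

theorem torusPoint_ne_zero (u θ : Fin n → ℝ) (i : Fin n) : torusPoint u θ i ≠ 0 := by
  rw [← norm_ne_zero_iff, norm_torusPoint_apply]
  exact (Real.exp_pos _).ne'

@[fun_prop]
theorem Continuous.torusPoint {X : Type*} [TopologicalSpace X] {u θ : X → Fin n → ℝ}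
    (hu : Continuous u) (hθ : Continuous θ) :
    Continuous fun x => Amoeba.torusPoint (u x) (θ x) := by
  refine continuous_pi fun i => ?_
  simp only [torusPoint_apply]
  fun_prop

@[fun_prop]
theorem Continuous.eval_mvPolynomial {X : Type*} [TopologicalSpace X] {z : X → Fin n → ℂ}
    (f : MvPolynomial (Fin n) ℂ) (hz : Continuous z) : Continuous fun x => eval (z x) f :=
  (MvPolynomial.continuous_eval f).comp hz

theorem continuous_add_single (θ : Fin n → ℝ) (j : Fin n) :
    Continuous fun t : ℝ => θ + Pi.single j t :=
  continuous_const.add (continuous_single (A := fun _ => ℝ) j)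

theorem continuous_torusPoint_add_single (u θ : Fin n → ℝ) (j : Fin n) :
    Continuous fun t : ℝ => torusPoint u (θ + Pi.single j t) :=
  Continuous.torusPoint continuous_const (continuous_add_single θ j)

theorem notMem_hypersurfaceAmoeba_iff {f : MvPolynomial (Fin n) ℂ} {u : Fin n → ℝ} :
    u ∉ hypersurfaceAmoeba f ↔ ∀ z : Fin n → ℂ, (∀ i, ‖z i‖ = Real.exp (u i)) → eval z f ≠ 0 := by
  constructor
  · intro hu z hz h0
    refine hu ⟨z, ?_, fun i => ?_, ?_⟩
    · rw [zeroLocus_span]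
      intro p hp
      rw [Set.mem_singleton_iff.mp hp, aeval_eq_eval]
      exact h0
    · rw [← norm_ne_zero_iff, hz]
      exact (Real.exp_pos _).ne'
    · ext i
      rw [hz, Real.log_exp]
  · rintro h ⟨z, hz, hz0, rfl⟩
    refine h z (fun i => (Real.exp_log (norm_pos_iff.mpr (hz0 i))).symm) ?_
    have := hz f (Ideal.subset_span rfl)
    rwa [aeval_eq_eval] at this

/-- The function `z_j ∂_j f(z) / f(z)`. -/
noncomputable def angularLogDeriv (f : MvPolynomial (Fin n) ℂ) (j : Fin n) (z : Fin n → ℂ) : ℂ :=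
  z j * eval z (pderiv j f) / eval z f

/-- Phrased with `pderiv j (X i)` to serve directly as the variable case in the induction for
general polynomials. -/
theorem hasDerivAt_torusPoint_add_single (u θ : Fin n → ℝ) (j i : Fin n) (t : ℝ) :
    HasDerivAt (fun t => torusPoint u (θ + Pi.single j t) i)
      (Complex.I * torusPoint u (θ + Pi.single j t) j * eval (torusPoint u (θ + Pi.single j t))
        (pderiv j (X i))) t := by
  simp only [torusPoint_apply, Pi.add_apply]
  by_cases h : i = j
  · subst h
    have h1 : HasDerivAt (fun t : ℝ => ((θ i + t : ℝ) : ℂ) * Complex.I) (1 * Complex.I) t :=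
      ((hasDerivAt_id t).const_add (θ i)).ofReal_comp.mul_const _
    simp only [Pi.single_eq_same, pderiv_X_self, map_one, mul_one]
    refine (h1.cexp.const_mul (Real.exp (u i) : ℂ)).congr_deriv ?_
    ring
  · simp only [Pi.single_eq_of_ne h, pderiv_X_of_ne h, map_zero, mul_zero]
    exact hasDerivAt_const _ _

/-- Chain rule along the circle, where `dz_j/dt = i z_j` and the other coordinates are fixed. -/
theorem hasDerivAt_eval_torusPoint (f : MvPolynomial (Fin n) ℂ) (u θ : Fin n → ℝ) (j : Fin n)
    (t : ℝ) :
    HasDerivAt (fun t => eval (torusPoint u (θ + Pi.single j t)) f)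
      (Complex.I * torusPoint u (θ + Pi.single j t) j *
        eval (torusPoint u (θ + Pi.single j t)) (pderiv j f)) t := by
  induction f using MvPolynomial.induction_on with
  | C a => simpa using hasDerivAt_const t a
  | add p q hp hq =>
    simp only [map_add, mul_add]
    exact hp.add hq
  | mul_X p i hp =>
    have h1 := hp.mul (hasDerivAt_torusPoint_add_single u θ j i t)
    simp only [map_mul, eval_X]
    refine h1.congr_deriv ?_
    simp only [Derivation.leibniz, map_add, map_mul, eval_X, smul_eq_mul]
    ring

theorem torusPoint_add_single_two_pi (u θ : Fin n → ℝ) (j : Fin n) :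
    torusPoint u (θ + Pi.single j (2 * Real.pi)) = torusPoint u (θ + Pi.single j 0) := by
  ext i
  simp only [torusPoint_apply, Pi.add_apply]
  by_cases h : i = j
  · subst h
    simp only [Pi.single_eq_same, Complex.ofReal_add, add_mul, Complex.exp_add]
    simp [Complex.exp_two_pi_mul_I]
  · simp [Pi.single_eq_of_ne h]

theorem continuous_angularLogDeriv {X : Type*} [TopologicalSpace X] {z : X → Fin n → ℂ}
    (f : MvPolynomial (Fin n) ℂ) (j : Fin n) (hz : Continuous z) (h0 : ∀ x, eval (z x) f ≠ 0) :
    Continuous fun x => angularLogDeriv f j (z x) :=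
  Continuous.div (by fun_prop) (by fun_prop) h0

/-- The winding number of the image under `f` of the `j`-th coordinate circle through the point over
`u` with the arguments `θ`. -/
noncomputable def windingNumber (f : MvPolynomial (Fin n) ℂ) (u θ : Fin n → ℝ) (j : Fin n) : ℂ :=
  (2 * Real.pi : ℂ)⁻¹ *
    ∫ t in 0..2 * Real.pi, angularLogDeriv f j (torusPoint u (θ + Pi.single j t))

theorem I_mul_angularLogDeriv (f : MvPolynomial (Fin n) ℂ) (j : Fin n) (z : Fin n → ℂ) :
    Complex.I * angularLogDeriv f j z = Complex.I * z j * eval z (pderiv j f) / eval z f := by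
  rw [angularLogDeriv, ← mul_div_assoc, mul_assoc]

theorem continuous_deriv_eval_torusPoint (f : MvPolynomial (Fin n) ℂ) (u θ : Fin n → ℝ)
    (j : Fin n) :
    Continuous fun t : ℝ => Complex.I * torusPoint u (θ + Pi.single j t) j *
      eval (torusPoint u (θ + Pi.single j t)) (pderiv j f) := by
  have := continuous_torusPoint_add_single u θ j
  fun_prop

theorem exists_int_windingNumber_eq {f : MvPolynomial (Fin n) ℂ} {u : Fin n → ℝ}
    (hu : u ∉ hypersurfaceAmoeba f) (θ : Fin n → ℝ) (j : Fin n) :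
    ∃ m : ℤ, windingNumber f u θ j = m := by
  obtain ⟨m, hm⟩ := exists_int_integral_div_eq (a := 0) (b := 2 * Real.pi)
    (hasDerivAt_eval_torusPoint f u θ j)
    (continuous_deriv_eval_torusPoint f u θ j)
    (fun t => notMem_hypersurfaceAmoeba_iff.mp hu _ (norm_torusPoint_apply u _))
    (by rw [torusPoint_add_single_two_pi])
  refine ⟨m, ?_⟩
  simp only [← I_mul_angularLogDeriv] at hm
  rw [intervalIntegral.integral_const_mul] at hm
  have hpi : (Real.pi : ℂ) ≠ 0 := by exact_mod_cast Real.pi_ne_zero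
  rw [windingNumber, inv_mul_eq_iff_eq_mul₀ (by simp)]
  refine mul_left_cancel₀ Complex.I_ne_zero (hm.trans ?_)
  ring

/-- An integer-valued continuous function on the connected space (component) × (arguments) is
constant. Letting the arguments vary too is what identifies the rotated winding numbers. -/
theorem windingNumber_eq_of_mem_connectedComponentIn {f : MvPolynomial (Fin n) ℂ}
    {w u v : Fin n → ℝ} (hu : u ∈ connectedComponentIn (hypersurfaceAmoeba f)ᶜ w)
    (hv : v ∈ connectedComponentIn (hypersurfaceAmoeba f)ᶜ w) (θ η : Fin n → ℝ) (j : Fin n) :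
    windingNumber f u θ j = windingNumber f v η j := by
  set S := connectedComponentIn (hypersurfaceAmoeba f)ᶜ w with hS
  have hS' : ∀ x ∈ S, x ∉ hypersurfaceAmoeba f := fun x hx =>
    connectedComponentIn_subset _ _ hx
  have : PreconnectedSpace S :=
    isPreconnected_iff_preconnectedSpace.mp isPreconnected_connectedComponentIn
  choose m hm using fun p : S × (Fin n → ℝ) =>
    exists_int_windingNumber_eq (hS' p.1 p.1.2) p.2 j
  have hc : Continuous fun p : S × (Fin n → ℝ) => windingNumber f p.1 p.2 j := by
    refine continuous_const.mul (intervalIntegral.continuous_parametric_intervalIntegral_of_continuous'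
      ?_ _ _)
    refine continuous_angularLogDeriv f j ?_ fun x =>
      notMem_hypersurfaceAmoeba_iff.mp (hS' _ x.1.1.2) _ (norm_torusPoint_apply _ _)
    refine Continuous.torusPoint (by fun_prop) (Continuous.add (by fun_prop) ?_)
    exact (continuous_single j).comp continuous_snd
  have hmc : Continuous m := by
    -- Continuity into `ℤ` is tested in `ℝ`, where `m` is the real part of the winding number.
    rw [Int.isClosedEmbedding_coe_real.isEmbedding.continuous_iff]
    refine (Complex.continuous_re.comp hc).congr fun p => ?_
    simp [hm]
  have := PreconnectedSpace.constant inferInstance hmc (x := (⟨u, hu⟩, θ)) (y := (⟨v, hv⟩, η))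
  rw [hm (⟨u, hu⟩, θ), hm (⟨v, hv⟩, η), this]

/-- The Jacobian `∏ i z_k` of the torus cancels the denominator and leaves `iⁿ`, so the order is the
average of the winding numbers over the torus. -/
theorem order_eq_of_windingNumber_eq {f : MvPolynomial (Fin n) ℂ} {u : Fin n → ℝ}
    (hu : u ∉ hypersurfaceAmoeba f) {j : Fin n} {c : ℂ} (hc : ∀ θ, windingNumber f u θ j = c) :
    order f u j = c := by
  obtain ⟨m, rfl⟩ : ∃ m, n = m + 1 := ⟨n - 1, by have := j.2; omega⟩
  have hpi : (2 * Real.pi : ℂ) ≠ 0 := by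
    simp
  have hF : Continuous fun θ => angularLogDeriv f j (torusPoint u θ) :=
    continuous_angularLogDeriv f j (by fun_prop) fun θ =>
      notMem_hypersurfaceAmoeba_iff.mp hu _ (norm_torusPoint_apply u θ)
  have hcube := setIntegral_cube_eq_of_slices hF j (T := 2 * Real.pi) (by positivity)
    (c := 2 * Real.pi * c) fun θ => by
      rw [← hc θ, windingNumber, mul_inv_cancel_left₀ hpi]
  have htor : torusIntegral (fun z => z j * eval z (pderiv j f) / eval z f / ∏ i, z i) 0
      (fun i => Real.exp (u i)) = Complex.I ^ (m + 1) *
        ∫ θ in Set.Icc (0 : Fin (m + 1) → ℝ) (fun _ => 2 * Real.pi),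
          angularLogDeriv f j (torusPoint u θ) := by
    rw [torusIntegral, ← MeasureTheory.integral_const_mul]
    congr 1
    ext θ
    have h1 : (∏ i, (Real.exp (u i) : ℂ) * Complex.exp (θ i * Complex.I) * Complex.I) =
        (∏ i, torusPoint u θ i) * Complex.I ^ (m + 1) := by
      simp only [Finset.prod_mul_distrib, torusPoint_apply, Finset.prod_const, Finset.card_univ,
        Fintype.card_fin]
    have h2 : (∏ i, torusPoint u θ i) ≠ 0 :=
      Finset.prod_ne_zero_iff.mpr fun i _ => torusPoint_ne_zero u θ i
    rw [h1, smul_eq_mul]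
    change (∏ i, torusPoint u θ i) * Complex.I ^ (m + 1) *
      (angularLogDeriv f j (torusPoint u θ) / ∏ i, torusPoint u θ i) = _
    field_simp
  rw [order, htor, hcube, mul_pow]
  push_cast
  have hI := Complex.I_ne_zero
  have h2 : (Real.pi : ℂ) ≠ 0 := by exact_mod_cast Real.pi_ne_zero
  field_simp
  ring

end WindingNumbers

end Amoeba

namespace Amoeba

/-! ### Rescaling, the product over rotations, and the certificate for `g`. -/

section Rescaling

variable {n : ℕ}

theorem coeff_rescale (c : Fin n → ℂ) (f : MvPolynomial (Fin n) ℂ) (b : Fin n →₀ ℕ) :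
    coeff b (rescale c f) = coeff b f * ∏ i, c i ^ b i := by
  classical
  induction f using MvPolynomial.induction_on' with
  | monomial d a =>
    have : rescale c (monomial d a) = monomial d (a * ∏ i, c i ^ d i) := by
      rw [rescale, aeval_monomial, Finsupp.prod_fintype _ _ fun _ => pow_zero _, monomial_eq,
        Finsupp.prod_fintype _ _ fun _ => pow_zero _]
      simp only [mul_pow, Finset.prod_mul_distrib, algebraMap_eq, C_mul, map_prod, C_pow]
      ring
    rw [this, coeff_monomial, coeff_monomial]
    split_ifs with h
    · rw [h]
    · rw [zero_mul]
  | add p q hp hq =>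
    have : rescale c (p + q) = rescale c p + rescale c q := map_add _ _ _
    rw [this, coeff_add, coeff_add, hp, hq, add_mul]

theorem rescale_rescale (c d : Fin n → ℂ) (f : MvPolynomial (Fin n) ℂ) :
    rescale c (rescale d f) = rescale (fun i => c i * d i) f := by
  ext b
  simp only [coeff_rescale, mul_pow, Finset.prod_mul_distrib]
  ring

theorem rescale_prod {ι : Type*} (c : Fin n → ℂ) (t : Finset ι)
    (f : ι → MvPolynomial (Fin n) ℂ) :
    rescale c (∏ k ∈ t, f k) = ∏ k ∈ t, rescale c (f k) := map_prod _ _ _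

theorem eval_rescale (c z : Fin n → ℂ) (f : MvPolynomial (Fin n) ℂ) :
    eval z (rescale c f) = eval (fun i => c i * z i) f := by
  rw [rescale, aeval_def, eval_eval₂, eval₂_eq, eval_eq]
  simp

theorem support_rescale {c : Fin n → ℂ} (hc : ∀ i, c i ≠ 0) (f : MvPolynomial (Fin n) ℂ) :
    (rescale c f).support = f.support := by
  ext b
  simp [mem_support_iff, coeff_rescale, Finset.prod_eq_zero_iff, hc]

theorem totalDegree_rescale {c : Fin n → ℂ} (hc : ∀ i, c i ≠ 0) (f : MvPolynomial (Fin n) ℂ) :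
    (rescale c f).totalDegree = f.totalDegree := by
  rw [totalDegree, support_rescale hc, totalDegree]

theorem normalize_ne_zero (w : Fin n → ℝ) (i : Fin n) : (Real.exp (w i) : ℂ) ≠ 0 := by
  exact_mod_cast (Real.exp_pos _).ne'

/-- Diagonal scalings commute. Hence lopsidedness at `w` can be moved to the origin after forming
the product. -/
theorem rootProduct_normalize (r : ℕ) (w : Fin n → ℝ) (f : MvPolynomial (Fin n) ℂ) :
    rootProduct r (normalize w f) = normalize w (rootProduct r f) := by
  simp only [rootProduct, normalize, rescale_prod, rescale_rescale]
  exact Finset.prod_congr rfl fun k _ => congrArg₂ _ (funext fun i => mul_comm _ _) rfl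

theorem isDominant_normalize_iff {w : Fin n → ℝ} {f : MvPolynomial (Fin n) ℂ} {a : Fin n →₀ ℕ} :
    IsDominant (normalize w f) 0 a ↔ IsDominant f w a := by
  have hterm : ∀ b, termAbs (normalize w f) 0 b = termAbs f w b := fun b => by
    simp only [termAbs, normalize, coeff_rescale, norm_mul, norm_prod, norm_pow, Complex.norm_real,
      Real.norm_of_nonneg (Real.exp_pos _).le]
    simp
  simp only [IsDominant, hterm]
  rw [normalize, support_rescale (normalize_ne_zero w)]

/-- The product of all rotations of `f` by `r`-th roots of unity, except for `f` itself. -/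
noncomputable def rootCofactor (r : ℕ) [NeZero r] (f : MvPolynomial (Fin n) ℂ) :
    MvPolynomial (Fin n) ℂ :=
  ∏ k ∈ (Finset.univ : Finset (Fin n → Fin r)).erase 0,
    rescale (fun i => Complex.exp (2 * Real.pi * Complex.I * ((k i : ℕ) : ℂ) / r)) f

theorem rescale_one (f : MvPolynomial (Fin n) ℂ) : rescale (fun _ => 1) f = f := by
  ext b
  simp [coeff_rescale]

theorem rootProduct_eq_mul (r : ℕ) [NeZero r] (f : MvPolynomial (Fin n) ℂ) :
    rootProduct r f = f * rootCofactor r f := by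
  rw [rootProduct, rootCofactor, ← Finset.mul_prod_erase _ _ (Finset.mem_univ 0)]
  simp [rescale_one]

theorem totalDegree_rootProduct_le (r : ℕ) (f : MvPolynomial (Fin n) ℂ) :
    (rootProduct r f).totalDegree ≤ r ^ n * f.totalDegree := by
  refine (totalDegree_finsetProd _ _).trans (le_of_eq ?_)
  simp only [totalDegree_rescale fun _ => Complex.exp_ne_zero _]
  simp

theorem totalDegree_rootCofactor_le (r : ℕ) [NeZero r] (f : MvPolynomial (Fin n) ℂ) :
    (rootCofactor r f).totalDegree ≤ (r ^ n - 1) * f.totalDegree := by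
  refine (totalDegree_finsetProd _ _).trans (le_of_eq ?_)
  simp only [totalDegree_rescale fun _ => Complex.exp_ne_zero _]
  simp [Finset.card_erase_of_mem]

theorem support_rootProduct_subset_closure (r : ℕ) (f : MvPolynomial (Fin n) ℂ) :
    ((rootProduct r f).support : Set (Fin n →₀ ℕ)) ⊆
      AddSubmonoid.closure (f.support : Set (Fin n →₀ ℕ)) := by
  refine support_prod_subset_closure _ _ _ fun k _ => ?_
  rw [support_rescale fun _ => Complex.exp_ne_zero _]
  exact AddSubmonoid.subset_closure

theorem exists_certificate_of_rootProduct (r : ℕ) [NeZero r] {g : MvPolynomial (Fin n) ℂ}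
    {a : Fin n →₀ ℕ} (ha : IsDominant (rootProduct r g) 0 a) :
    ∃ K : Certificate n, K.IsValid g (2 * r ^ n * g.totalDegree) ∧
      K.sos = (lopsidedCertificate (rootProduct r g) a).sos := by
  have hdeg := totalDegree_rootProduct_le r g
  have hv : (lopsidedCertificate (rootProduct r g) a).IsValid (g * rootCofactor r g)
      (2 * r ^ n * g.totalDegree) := by
    rw [← rootProduct_eq_mul]
    exact (lopsidedCertificate_isValid ha).mono (by
      rw [mul_assoc]; exact Nat.mul_le_mul_left _ hdeg)
  refine hv.of_mul (d := r ^ n * g.totalDegree)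
    (fun b => lopsidedCertificate_monMult_eq_C _ a b)
    ((totalDegree_lopsidedCertificate_reMult_le _ a).trans hdeg)
    ((totalDegree_lopsidedCertificate_imMult_le _ a).trans hdeg) ?_ ?_ ?_
  · have h1 := totalDegree_rootCofactor_le r g
    obtain ⟨N, hN⟩ : ∃ N, r ^ n = N + 1 :=
      ⟨r ^ n - 1, (Nat.succ_pred_eq_of_pos (Nat.pow_pos (NeZero.pos r))).symm⟩
    rw [hN, Nat.add_sub_cancel] at h1
    rw [hN]
    -- The cofactor omits one of the `N + 1 = r ^ n` factors; this saved degree pays for `g` itself,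
    -- giving exactly `2 r ^ n deg g`.
    calc _ ≤ g.totalDegree + ((N + 1) * g.totalDegree + N * g.totalDegree) := by gcongr
      _ = 2 * (N + 1) * g.totalDegree := by ring
  · rw [← rootProduct_eq_mul, mul_assoc]
    exact Nat.mul_le_mul_left _ hdeg
  · rw [← rootProduct_eq_mul]
    exact support_rootProduct_subset_closure r g

end Rescaling

/-! ### Dominant exponents and orders of components. -/

section Orders

variable {n : ℕ}

theorem eval_term (h : MvPolynomial (Fin n) ℂ) (b : Fin n →₀ ℕ) (z : Fin n → ℂ) :
    eval z (term h b) = coeff b h * ∏ i, z i ^ b i := by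
  rw [term, eval_monomial, Finsupp.prod_fintype _ _ fun _ => pow_zero _]

theorem norm_eval_term {u : Fin n → ℝ} {z : Fin n → ℂ} (hz : ∀ i, ‖z i‖ = Real.exp (u i))
    (h : MvPolynomial (Fin n) ℂ) (b : Fin n →₀ ℕ) : ‖eval z (term h b)‖ = termAbs h u b := by
  simp only [eval_term, norm_mul, norm_prod, norm_pow, hz, termAbs]

/-- The triangle inequality over the remaining terms; this is the hypothesis of Rouché's theorem and
also excludes zeros. -/
theorem norm_eval_sub_term_lt {h : MvPolynomial (Fin n) ℂ} {u : Fin n → ℝ} {a : Fin n →₀ ℕ}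
    (ha : IsDominant h u a) {z : Fin n → ℂ} (hz : ∀ i, ‖z i‖ = Real.exp (u i)) :
    ‖eval z h - eval z (term h a)‖ < ‖eval z (term h a)‖ := by
  classical
  have h1 : eval z h - eval z (term h a) = ∑ b ∈ h.support.erase a, eval z (term h b) := by
    rw [← map_sum, sub_eq_iff_eq_add, ← map_add, Finset.sum_erase_add _ _ ha.1, sum_term]
  rw [h1, norm_eval_term hz]
  refine (norm_sum_le _ _).trans_lt ?_
  simp only [norm_eval_term hz]
  exact ha.2

theorem IsDominant.notMem_hypersurfaceAmoeba {h : MvPolynomial (Fin n) ℂ} {u : Fin n → ℝ}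
    {a : Fin n →₀ ℕ} (ha : IsDominant h u a) : u ∉ hypersurfaceAmoeba h := by
  refine notMem_hypersurfaceAmoeba_iff.mpr fun z hz h0 => ?_
  have := norm_eval_sub_term_lt ha hz
  rw [h0, zero_sub, norm_neg] at this
  exact lt_irrefl _ this

theorem notMem_hypersurfaceAmoeba_of_mul {f q : MvPolynomial (Fin n) ℂ} {u : Fin n → ℝ}
    (hu : u ∉ hypersurfaceAmoeba (f * q)) : u ∉ hypersurfaceAmoeba f :=
  notMem_hypersurfaceAmoeba_iff.mpr fun z hz h0 =>
    notMem_hypersurfaceAmoeba_iff.mp hu z hz (by rw [map_mul, h0, zero_mul])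

/-- A monomial is an eigenvector of `z_j ∂_j` with eigenvalue its `j`-th exponent. -/
theorem angularLogDeriv_term {h : MvPolynomial (Fin n) ℂ} {a : Fin n →₀ ℕ} {z : Fin n → ℂ}
    (h0 : eval z (term h a) ≠ 0) (j : Fin n) : angularLogDeriv (term h a) j z = a j := by
  have h1 : X j * pderiv j (term h a) = C (a j : ℂ) * term h a := by
    rw [term, pderiv_monomial, C_mul_monomial, X, monomial_mul, one_mul]
    -- If `a j = 0`, truncated subtraction does not restore the exponent, but both sides vanish.
    by_cases hj : a j = 0
    · simp [hj]
    · rw [mul_comm, add_tsub_cancel_of_le (Finsupp.single_le_iff.mpr (Nat.pos_of_ne_zero hj))]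
  have h2 := congrArg (eval z) h1
  rw [map_mul, map_mul, eval_X, eval_C] at h2
  rw [angularLogDeriv, h2, mul_div_cancel_right₀ _ h0]

theorem windingNumber_of_isDominant {h : MvPolynomial (Fin n) ℂ} {u : Fin n → ℝ} {a : Fin n →₀ ℕ}
    (ha : IsDominant h u a) (θ : Fin n → ℝ) (j : Fin n) : windingNumber h u θ j = a j := by
  have hlt : ∀ t : ℝ, ‖eval (torusPoint u (θ + Pi.single j t)) h -
      eval (torusPoint u (θ + Pi.single j t)) (term h a)‖ <
        ‖eval (torusPoint u (θ + Pi.single j t)) (term h a)‖ := fun t => by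
    have hz := norm_torusPoint_apply u (θ + Pi.single j t)
    exact norm_eval_sub_term_lt ha hz
  have hint := integral_div_eq_of_norm_sub_lt (a := 0) (b := 2 * Real.pi)
    (hasDerivAt_eval_torusPoint h u θ j) (hasDerivAt_eval_torusPoint (term h a) u θ j)
    (continuous_deriv_eval_torusPoint h u θ j) (continuous_deriv_eval_torusPoint _ u θ j) hlt
    (by rw [torusPoint_add_single_two_pi]) (by rw [torusPoint_add_single_two_pi])
  simp only [← I_mul_angularLogDeriv] at hint
  rw [intervalIntegral.integral_const_mul, intervalIntegral.integral_const_mul] at hint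
  have hterm : ∀ t, angularLogDeriv (term h a) j (torusPoint u (θ + Pi.single j t)) = a j :=
    fun t => angularLogDeriv_term (norm_pos_iff.mp (lt_of_le_of_lt (norm_nonneg _) (hlt t))) j
  have hpi : (Real.pi : ℂ) ≠ 0 := by exact_mod_cast Real.pi_ne_zero
  simp only [hterm] at hint
  have hint' := mul_left_cancel₀ Complex.I_ne_zero hint
  rw [windingNumber, hint']
  rw [intervalIntegral.integral_const]
  simp only [sub_zero, Complex.real_smul]
  push_cast
  field_simp

/-- The arguments of the root of unity `(e^(2πi k₁/r), …, e^(2πi kₙ/r))`. -/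
noncomputable def rootArg (r : ℕ) (k : Fin n → Fin r) (i : Fin n) : ℝ := 2 * Real.pi * (k i : ℕ) / r

theorem eval_torusPoint_rootProduct (r : ℕ) (f : MvPolynomial (Fin n) ℂ) (u θ : Fin n → ℝ) :
    eval (torusPoint u θ) (rootProduct r f) =
      ∏ k : Fin n → Fin r, eval (torusPoint u (θ + rootArg r k)) f := by
  rw [rootProduct, map_prod]
  refine Finset.prod_congr rfl fun k _ => ?_
  rw [eval_rescale]
  congr 2
  ext i
  rw [torusPoint_apply, torusPoint_apply, Pi.add_apply, rootArg]
  push_cast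
  rw [add_mul, Complex.exp_add]
  ring_nf

theorem logDeriv_eval_torusPoint (h : MvPolynomial (Fin n) ℂ) (u θ : Fin n → ℝ) (j : Fin n)
    (t : ℝ) :
    logDeriv (fun t => eval (torusPoint u (θ + Pi.single j t)) h) t =
      Complex.I * angularLogDeriv h j (torusPoint u (θ + Pi.single j t)) := by
  rw [logDeriv_apply, (hasDerivAt_eval_torusPoint h u θ j t).deriv, I_mul_angularLogDeriv]

theorem eval_torusPoint_ne_zero {f : MvPolynomial (Fin n) ℂ} {u : Fin n → ℝ}
    (hu : u ∉ hypersurfaceAmoeba f) (θ : Fin n → ℝ) : eval (torusPoint u θ) f ≠ 0 :=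
  notMem_hypersurfaceAmoeba_iff.mp hu _ (norm_torusPoint_apply u θ)

theorem angularLogDeriv_rootProduct (r : ℕ) {f : MvPolynomial (Fin n) ℂ} {u : Fin n → ℝ}
    (hu : u ∉ hypersurfaceAmoeba f) (θ : Fin n → ℝ) (j : Fin n) (t : ℝ) :
    angularLogDeriv (rootProduct r f) j (torusPoint u (θ + Pi.single j t)) =
      ∑ k : Fin n → Fin r,
        angularLogDeriv f j (torusPoint u (θ + rootArg r k + Pi.single j t)) := by
  set γ : (Fin n → Fin r) → ℝ → ℂ := fun k t =>
    eval (torusPoint u (θ + rootArg r k + Pi.single j t)) f with hγ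
  have h0 : ∀ k, γ k t ≠ 0 := fun k => eval_torusPoint_ne_zero hu _
  have hd : ∀ k, DifferentiableAt ℝ (γ k) t := fun k => by
    have := hasDerivAt_eval_torusPoint f u (θ + rootArg r k) j t
    exact this.differentiableAt
  have hprod : (fun t => eval (torusPoint u (θ + Pi.single j t)) (rootProduct r f)) =
      fun t => ∏ k, γ k t := by
    ext t
    rw [eval_torusPoint_rootProduct]
    exact Finset.prod_congr rfl fun k _ => by rw [add_right_comm]
  refine mul_left_cancel₀ Complex.I_ne_zero ?_
  rw [← logDeriv_eval_torusPoint, hprod, logDeriv_prod (fun k _ => h0 k) fun k _ => hd k,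
    Finset.mul_sum]
  exact Finset.sum_congr rfl fun k _ => logDeriv_eval_torusPoint f u (θ + rootArg r k) j t

/-- Rotating a polynomial shifts the arguments of the base point, and logarithmic derivatives turn
products into sums. -/
theorem windingNumber_rootProduct (r : ℕ) {f : MvPolynomial (Fin n) ℂ} {u : Fin n → ℝ}
    (hu : u ∉ hypersurfaceAmoeba f) (θ : Fin n → ℝ) (j : Fin n) :
    windingNumber (rootProduct r f) u θ j =
      ∑ k : Fin n → Fin r, windingNumber f u (θ + rootArg r k) j := by
  have hc : ∀ k : Fin n → Fin r, Continuous fun t =>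
      angularLogDeriv f j (torusPoint u (θ + rootArg r k + Pi.single j t)) := fun k => by
    refine continuous_angularLogDeriv f j (continuous_torusPoint_add_single u _ j) fun t => ?_
    exact eval_torusPoint_ne_zero hu _
  simp only [windingNumber, angularLogDeriv_rootProduct r hu]
  rw [intervalIntegral.integral_finsetSum fun k _ => (hc k).intervalIntegrable _ _,
    Finset.mul_sum]

/-- A dominant exponent of the product over all rotations by roots of unity is a multiple of the
order of the component. -/
theorem exists_order_eq_of_isDominant_rootProduct (r : ℕ) [NeZero r]
    {f : MvPolynomial (Fin n) ℂ} {w : Fin n → ℝ} {a : Fin n →₀ ℕ}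
    (ha : IsDominant (rootProduct r f) w a) (hw : w ∉ hypersurfaceAmoeba f) :
    ∃ ν : Fin n →₀ ℕ, a = r ^ n • ν ∧
      ∀ u ∈ connectedComponentIn (hypersurfaceAmoeba f)ᶜ w, ∀ j, order f u j = (ν j : ℂ) := by
  have hwc : w ∈ connectedComponentIn (hypersurfaceAmoeba f)ᶜ w := mem_connectedComponentIn hw
  have hrn : 0 < r ^ n := Nat.pow_pos (NeZero.pos r)
  have key : ∀ j, ∃ m : ℕ, a j = r ^ n * m ∧ windingNumber f w 0 j = m := fun j => by
    obtain ⟨m, hm⟩ := exists_int_windingNumber_eq hw 0 j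
    have h1 := windingNumber_rootProduct r hw 0 j
    rw [windingNumber_of_isDominant ha] at h1
    -- All `r ^ n` summands agree with the winding number at arguments 0, so `a j = r ^ n * m`; then
    -- `a j ≥ 0` forces `m ≥ 0`.
    simp only [windingNumber_eq_of_mem_connectedComponentIn hwc hwc _ 0 j, hm] at h1
    simp only [Finset.sum_const, Finset.card_univ, Fintype.card_fun, Fintype.card_fin,
      nsmul_eq_mul] at h1
    have h2 : (a j : ℤ) = ((r ^ n : ℕ) : ℤ) * m := by exact_mod_cast h1
    have hm0 : 0 ≤ m := by
      refine nonneg_of_mul_nonneg_right (h2 ▸ Int.natCast_nonneg (a j)) ?_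
      exact_mod_cast hrn
    lift m to ℕ using hm0
    exact ⟨m, by exact_mod_cast h2, by exact_mod_cast hm⟩
  choose ν hν hνw using key
  refine ⟨Finsupp.equivFunOnFinite.symm ν, ?_, fun u hu j => ?_⟩
  · ext j
    simp [hν j]
  · refine order_eq_of_windingNumber_eq (connectedComponentIn_subset _ _ hu) fun θ => ?_
    rw [windingNumber_eq_of_mem_connectedComponentIn hu hwc θ 0 j, hνw]
    rfl

end Orders

end Amoeba

theorem mainTheorem2 (n r : ℕ) (hr : 1 ≤ r) (f : MvPolynomial (Fin n) ℂ) (w : Fin n → ℝ)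
    (hw : w ∉ Amoeba.lopsidedApprox (Amoeba.rootProduct r f)) :
    w ∉ Amoeba.hypersurfaceAmoeba f ∧
    ∃ a : Fin n →₀ ℕ,
      -- the explicit certificate, with respect to the polynomial `g̃_r`
      Amoeba.IsDominant (Amoeba.rootProduct r (Amoeba.normalize w f)) 0 a ∧
      (Amoeba.lopsidedCertificate (Amoeba.rootProduct r (Amoeba.normalize w f)) a).IsValid
        (Amoeba.rootProduct r (Amoeba.normalize w f)) (2 * r ^ n * f.totalDegree) ∧
      -- it yields a certificate with respect to `g` itself, within the same degree bound
      (∃ K : Amoeba.Certificate n,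
        K.IsValid (Amoeba.normalize w f) (2 * r ^ n * f.totalDegree) ∧
        K.sos =
          (Amoeba.lopsidedCertificate (Amoeba.rootProduct r (Amoeba.normalize w f)) a).sos) ∧
      -- the exponent `a` is the only one whose multiplier in the certificate is positive, ...
      (∀ b ∈ (Amoeba.rootProduct r (Amoeba.normalize w f)).support,
        0 < MvPolynomial.coeff 0
          ((Amoeba.lopsidedCertificate
            (Amoeba.rootProduct r (Amoeba.normalize w f)) a).monMult b) ↔ b = a) ∧
      -- ... and it determines the order of the component of the complement that contains `w`
      ∃ ν : Fin n →₀ ℕ, a = r ^ n • ν ∧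
        ∀ u ∈ connectedComponentIn (Amoeba.hypersurfaceAmoeba f)ᶜ w, ∀ j,
          Amoeba.order f u j = (ν j : ℂ) := by
  have : NeZero r := ⟨by omega⟩
  obtain ⟨a, ha⟩ : ∃ a, Amoeba.IsDominant (Amoeba.rootProduct r f) w a := not_not.mp hw
  have hwf : w ∉ Amoeba.hypersurfaceAmoeba f :=
    Amoeba.notMem_hypersurfaceAmoeba_of_mul
      (Amoeba.rootProduct_eq_mul r f ▸ ha.notMem_hypersurfaceAmoeba)
  have ha0 : Amoeba.IsDominant (Amoeba.rootProduct r (Amoeba.normalize w f)) 0 a := by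
    rw [Amoeba.rootProduct_normalize]
    exact Amoeba.isDominant_normalize_iff.mpr ha
  have hdeg : (Amoeba.normalize w f).totalDegree = f.totalDegree :=
    Amoeba.totalDegree_rescale (Amoeba.normalize_ne_zero w) f
  rw [← hdeg]
  refine ⟨hwf, a, ha0, (Amoeba.lopsidedCertificate_isValid ha0).mono ?_,
    Amoeba.exists_certificate_of_rootProduct r ha0,
    fun b _ => Amoeba.coeff_zero_lopsidedCertificate_monMult_pos_iff ha0 b,
    Amoeba.exists_order_eq_of_isDominant_rootProduct r ha hwf⟩
  rw [mul_assoc]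
  exact Nat.mul_le_mul_left _ (Amoeba.totalDegree_rootProduct_le r _)
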